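/- Let $\Gamma$ be a distance-regular graph (finite, undirected, connected, no loops or multiple edges) with vertex set $X$, path-length distance $\partial$ and diameter $D\ge 3$. Let $A_0,\dots,A_D\in{\rm Mat}_X(\mathbb C)$ be its distance matrices, where $(A_i)_{y,z}=1$ if $\partial(y,z)=i$ and $0$ otherwise, and let $M$ be their span (the Bose-Mesner algebra). Let $E_0,\dots,E_D$ be an ordering of the primitive idempotents of $M$, that is, a basis of $M$ with $E_iE_j=\delta_{i,j}E_i$, $\sum_i E_i=I$ and $E_0=|X|^{-1}J$, where $J$ is the all-ones matrix. Let $P,Q$ be the eigenmatrices, defined by $A_j=\sum_{i=0}^D P_{i,j}E_i$ and $E_j=|X|^{-1}\sum_{i=0}^D Q_{i,j}A_i$ $(0\le j\le D)$, and put $\theta_i=P_{i,1}$, $\theta^*_i=Q_{i,1}$. Assume that the ordering is formally self-dual, i.e. $P=Q$, and of $q$-Racah type: $q,a,\alpha,\varepsilon\in\mathbb C$ satisfy $q\ne0$, $q^2\ne1$, $q^2\neq-1$, $a\ne0$, $\alpha\neq0$ and $$\theta_i=\theta_i^*=\alpha\vartheta_i+\varepsilon\quad(0\le i\le D),\qquad\text{where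 } \vartheta_i=aq^{2i-D}+a^{-1}q^{D-2i}.$$ Fix $x\in X$. Let $E^*_i$ be the diagonal matrix with $(y,y)$-entry $1$ if $\partial(x,y)=i$ and $0$ otherwise, let $M^*$ be the span of $E^*_0,\dots,E^*_D$ (the dual Bose-Mesner algebra), and let $A^*$ be the diagonal matrix with $(y,y)$-entry $|X|(E_1)_{x,y}$. Put $$\mathsf A=\frac{A_1-\varepsilon I}{\alpha},\qquad \mathsf B=\frac{A^*-\varepsilon I}{\alpha},$$ assume that $$\sum_{i=0}^D E^*_i\mathsf A E^*_i\Bigl(1+\frac{\vartheta_i}{q+q^{-1}}\Bigr)=\sum_{i=0}^D E_i\mathsf B E_i\Bigl(1+\frac{\vartheta_i}{q+q^{-1}}\Bigr),$$ let $Z$ be the common value, and put $$\mathsf C=Z-\frac{q\mathsf A\mathsf B-q^{-1}\mathsf B\mathsf A}{q^2-q^{-2}}.$$ (1) Let $W=\sum_{i=0}^D\alpha_iE_i\in M$ be invertible ($\alpha_i\in\mathbb C$). The following are equivalent: (i) $W^{-1}\mathsf BW=\mathsf C$; (ii) $\dfrac{\alpha_j}{\alpha_i}=\dfrac{q^{-1}\vartheta_j-q\vartheta_i}{q^2-q^{-2}}$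 for all $0\le i,j\le D$ with $|i-j|=1$; (iii) $\dfrac{\alpha_i}{\alpha_{i-1}}=\dfrac{q^{-1}\vartheta_i-q\vartheta_{i-1}}{q^2-q^{-2}}$ for $1\le i\le D$; (iv) $\dfrac{\alpha_i}{\alpha_{i-1}}=-a^{-1}q^{D-2i+1}$ for $1\le i\le D$; (v) $\alpha_i=\alpha_0(-1)^ia^{-i}q^{i(D-i)}$ for $0\le i\le D$. (2) Let $W^*=\sum_{i=0}^D\alpha^*_iE^*_i\in M^*$ be invertible ($\alpha^*_i\in\mathbb C$). The following are equivalent: (i) $W^*\mathsf A(W^*)^{-1}=\mathsf C$; (ii) $\dfrac{\alpha^*_i}{\alpha^*_j}=\dfrac{q^{-1}\vartheta_i-q\vartheta_j}{q^2-q^{-2}}$ for all $0\le i,j\le D$ with $|i-j|=1$; (iii) $\dfrac{\alpha^*_i}{\alpha^*_{i-1}}=\dfrac{q^{-1}\vartheta_i-q\vartheta_{i-1}}{q^2-q^{-2}}$ for $1\le i\le D$; (iv) $\dfrac{\alpha^*_i}{\alpha^*_{i-1}}=-a^{-1}q^{D-2i+1}$ for $1\le i\le D$; (v) $\alpha^*_i=\alpha^*_0(-1)^ia^{-i}q^{i(D-i)}$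 for $0\le i\le D$. -/

import Mathlib

open scoped BigOperators

namespace DRG

noncomputable section

/-- A finite connected graph is distance-regular when the number
`|Γ_i(y) ∩ Γ_j(z)|` depends only on `i`, `j` and `h = ∂(y,z)`
(for `i` or `j` above the diameter the number is `0`, so no range is needed). -/
structure IsDistanceRegular {X : Type*} [Fintype X] (G : SimpleGraph X) : Prop where
  connected : G.Connected
  exists_intersection_numbers : ∃ p : ℕ → ℕ → ℕ → ℕ, ∀ (h i j : ℕ) (y z : X),
    G.dist y z = h →
      (Finset.univ.filter fun w : X => G.dist y w = i ∧ G.dist z w = j).card = p h i j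

/-- The distance matrix `A_i`. The adjacency matrix is `A = A_1`. -/
def distanceMatrix {X : Type*} (G : SimpleGraph X) (i : ℕ) : Matrix X X ℂ :=
  Matrix.of fun y z => if G.dist y z = i then 1 else 0

/-- The Bose-Mesner algebra `M`, the span of the distance matrices
(those with index above the diameter are zero). -/
def boseMesner {X : Type*} (G : SimpleGraph X) : Submodule ℂ (Matrix X X ℂ) :=
  Submodule.span ℂ (Set.range (distanceMatrix G))

/-- `E 0, …, E D` is an ordering of the primitive idempotents of `G`: a basis of the
Bose-Mesner algebra formed by mutually orthogonal idempotents with sum `I`, that starts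
with `|X|⁻¹ J`. (That each `E i` is symmetric with real entries is automatic.) -/
structure IsPrimitiveIdempotentOrdering {X : Type*} [Fintype X] [DecidableEq X]
    (G : SimpleGraph X) {D : ℕ} (E : Fin (D + 1) → Matrix X X ℂ) : Prop where
  linearIndependent : LinearIndependent ℂ E
  span_eq : Submodule.span ℂ (Set.range E) = boseMesner G
  complete : CompleteOrthogonalIdempotents E
  zero_eq : E 0 = (Fintype.card X : ℂ)⁻¹ • Matrix.of fun _ _ => (1 : ℂ)

/-- `P` is the first eigenmatrix: `A_j = ∑ i, P i j • E i`. -/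
def IsFirstEigenmatrix {X : Type*} (G : SimpleGraph X) {D : ℕ}
    (E : Fin (D + 1) → Matrix X X ℂ) (P : Matrix (Fin (D + 1)) (Fin (D + 1)) ℂ) : Prop :=
  ∀ j : Fin (D + 1), distanceMatrix G j = ∑ i, P i j • E i

/-- `Q` is the second eigenmatrix: `E_j = |X|⁻¹ ∑ i, Q i j • A_i`. -/
def IsSecondEigenmatrix {X : Type*} [Fintype X] (G : SimpleGraph X) {D : ℕ}
    (E : Fin (D + 1) → Matrix X X ℂ) (Q : Matrix (Fin (D + 1)) (Fin (D + 1)) ℂ) : Prop :=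
  ∀ j : Fin (D + 1),
    E j = (Fintype.card X : ℂ)⁻¹ • ∑ i : Fin (D + 1), Q i j • distanceMatrix G i

/-- The dual primitive idempotent `E*_i` with respect to the base vertex `x`. -/
def dualIdempotent {X : Type*} [DecidableEq X] (G : SimpleGraph X) (x : X) (i : ℕ) :
    Matrix X X ℂ :=
  Matrix.diagonal fun y => if G.dist x y = i then 1 else 0

/-- The dual Bose-Mesner algebra `M*` with respect to `x`, the span of the dual primitive
idempotents (those with index above the diameter are zero). -/
def dualBoseMesner {X : Type*} [DecidableEq X] (G : SimpleGraph X) (x : X) :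
    Submodule ℂ (Matrix X X ℂ) :=
  Submodule.span ℂ (Set.range (dualIdempotent G x))

/-- The dual distance matrix `A*_i` with respect to `x` and the ordering `E`: it is diagonal
with `(y,y)`-entry `|X| (E_i)_{x,y}`. The dual adjacency matrix is `A* = A*_1`. -/
def dualDistanceMatrix {X : Type*} [Fintype X] [DecidableEq X] {D : ℕ}
    (E : Fin (D + 1) → Matrix X X ℂ) (x : X) (i : Fin (D + 1)) : Matrix X X ℂ :=
  Matrix.diagonal fun y => (Fintype.card X : ℂ) * E i x y

/-- `ϑ_i = a q^(2i-D) + a⁻¹ q^(D-2i)`. -/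
def vartheta (a q : ℂ) (D : ℕ) (i : ℤ) : ℂ :=
  a * q ^ (2 * i - (D : ℤ)) + a⁻¹ * q ^ ((D : ℤ) - 2 * i)

end

end DRG

/-! Compare both sides of $W^{-1}\mathsf BW=\mathsf C$ block by block, multiplying by $E_i$ on the
left and $E_j$ on the right. Since $\mathsf A=\sum_i\vartheta_iE_i$, the left side becomes
$(\alpha_j/\alpha_i)E_i\mathsf BE_j$. The right side becomes $E_i\mathsf BE_i$ if $i=j$, because $Z$
is built to cancel the diagonal part of the $q$-commutator, and
$\frac{q^{-1}\vartheta_j-q\vartheta_i}{q^2-q^{-2}}E_i\mathsf BE_j$ otherwise. So (i) says that the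
ratios are prescribed wherever the block is nonzero (`conj_eq_iff`).

For $i\ne j$ the block is nonzero exactly when $|i-j|=1$. By self-duality the Krein parameters equal
the intersection numbers, so a norm computation reduces this to $p^1_{i,j}\ne0$
(`idempotent_mul_dualDistanceMatrix_ne_zero_iff`, `intersection_number_one_ne_zero_iff`). Part (2)
is the same argument with the $E^*_i$, the roles of $\mathsf A,\mathsf B$ exchanged and the other
expression for $Z$. The remaining equivalences are scalar identities (`tfae_of_iff_ratio`). -/

namespace DRG

open scoped Matrix ComplexOrder

/-! ### Scalar identities for the ratios of coefficients. -/

section Scalars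

variable {q a : ℂ}

lemma sq_sub_zpow_neg_two_ne_zero (hq0 : q ≠ 0) (hq1 : q ^ 2 ≠ 1) (hq2 : q ^ 2 ≠ -1) :
    q ^ 2 - q ^ (-2 : ℤ) ≠ 0 := by
  intro h
  have h4 : (q ^ 2 - 1) * (q ^ 2 + 1) = 0 := by
    rw [zpow_neg] at h
    norm_cast at h
    field_simp at h
    linear_combination h
  rcases mul_eq_zero.1 h4 with h | h
  · exact hq1 (sub_eq_zero.1 h)
  · exact hq2 (eq_neg_of_add_eq_zero_left h)

lemma add_inv_ne_zero (hq0 : q ≠ 0) (hq2 : q ^ 2 ≠ -1) : q + q⁻¹ ≠ 0 := by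
  intro h
  apply hq2
  field_simp at h
  linear_combination h

/-- The terms in $a$ cancel, and the terms in $a^{-1}$ leave a multiple of $q^2-q^{-2}$. -/
lemma vartheta_ratio_up (hq0 : q ≠ 0) (hq1 : q ^ 2 ≠ 1) (hq2 : q ^ 2 ≠ -1) (D : ℕ) (i : ℤ) :
    (q⁻¹ * vartheta a q D (i + 1) - q * vartheta a q D i) / (q ^ 2 - q ^ (-2 : ℤ)) =
      -a⁻¹ * q ^ ((D : ℤ) - 2 * (i + 1) + 1) := by
  rw [div_eq_iff (sq_sub_zpow_neg_two_ne_zero hq0 hq1 hq2)]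
  have e1 : q ^ (2 * (i + 1) - (D : ℤ)) = q ^ (2 * i - (D : ℤ)) * q ^ 2 := by
    rw [← zpow_natCast q 2, ← zpow_add₀ hq0]; congr 1; push_cast; ring
  have e2 : q ^ ((D : ℤ) - 2 * i) = q ^ ((D : ℤ) - 2 * (i + 1)) * q ^ 2 := by
    rw [← zpow_natCast q 2, ← zpow_add₀ hq0]; congr 1; push_cast; ring
  have e3 : q ^ (-2 : ℤ) = (q ^ 2)⁻¹ := by rw [zpow_neg]; norm_cast
  rw [vartheta, vartheta, e1, e2, e3, zpow_add₀ hq0 _ 1, zpow_one]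
  field_simp
  ring

/-- Here the terms in $a^{-1}$ cancel. The value is the reciprocal of the one in
`vartheta_ratio_up`, so conditions on the pairs $(i+1,i)$ and $(i,i+1)$ are consistent and
equivalent. -/
lemma vartheta_ratio_down (hq0 : q ≠ 0) (hq1 : q ^ 2 ≠ 1) (hq2 : q ^ 2 ≠ -1) (ha : a ≠ 0)
    (D : ℕ) (i : ℤ) :
    (q⁻¹ * vartheta a q D i - q * vartheta a q D (i + 1)) / (q ^ 2 - q ^ (-2 : ℤ)) =
      (-a⁻¹ * q ^ ((D : ℤ) - 2 * (i + 1) + 1))⁻¹ := by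
  have e0 : (-a⁻¹ * q ^ ((D : ℤ) - 2 * (i + 1) + 1))⁻¹ = -a * q ^ (2 * i - (D : ℤ)) * q := by
    rw [mul_inv, ← zpow_neg, mul_assoc, ← zpow_add_one₀ hq0, neg_inv, inv_inv]
    congr 2; ring
  rw [e0, div_eq_iff (sq_sub_zpow_neg_two_ne_zero hq0 hq1 hq2)]
  have e1 : q ^ (2 * (i + 1) - (D : ℤ)) = q ^ (2 * i - (D : ℤ)) * q ^ 2 := by
    rw [← zpow_natCast q 2, ← zpow_add₀ hq0]; congr 1; push_cast; ring
  have e2 : q ^ ((D : ℤ) - 2 * i) = q ^ ((D : ℤ) - 2 * (i + 1)) * q ^ 2 := by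
    rw [← zpow_natCast q 2, ← zpow_add₀ hq0]; congr 1; push_cast; ring
  have e3 : q ^ (-2 : ℤ) = (q ^ 2)⁻¹ := by rw [zpow_neg]; norm_cast
  rw [vartheta, vartheta, e1, e2, e3]
  field_simp
  ring

lemma ratio_adjacent_iff (hq0 : q ≠ 0) (hq1 : q ^ 2 ≠ 1) (hq2 : q ^ 2 ≠ -1) (ha : a ≠ 0)
    {D : ℕ} (c : Fin (D + 1) → ℂ) :
    (∀ i j : Fin (D + 1), |(i : ℤ) - (j : ℤ)| = 1 →
        c i / c j = (q⁻¹ * vartheta a q D i - q * vartheta a q D j) / (q ^ 2 - q ^ (-2 : ℤ))) ↔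
      ∀ i j : Fin (D + 1), (i : ℕ) = (j : ℕ) + 1 →
        c i / c j =
          (q⁻¹ * vartheta a q D i - q * vartheta a q D j) / (q ^ 2 - q ^ (-2 : ℤ)) := by
  refine ⟨fun h i j hij => h i j (by rw [hij]; simp), fun h i j hij => ?_⟩
  rcases (abs_eq zero_le_one).1 hij with h1 | h1
  · exact h i j (by omega)
  · have hji : (j : ℤ) = (i : ℤ) + 1 := by omega
    have := h j i (by omega)
    rw [hji, vartheta_ratio_up hq0 hq1 hq2] at this
    rw [hji, vartheta_ratio_down hq0 hq1 hq2 ha, ← this, inv_div]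

lemma ratio_vartheta_iff (hq0 : q ≠ 0) (hq1 : q ^ 2 ≠ 1) (hq2 : q ^ 2 ≠ -1)
    {D : ℕ} (c : Fin (D + 1) → ℂ) :
    (∀ i j : Fin (D + 1), (i : ℕ) = (j : ℕ) + 1 →
        c i / c j =
          (q⁻¹ * vartheta a q D i - q * vartheta a q D j) / (q ^ 2 - q ^ (-2 : ℤ))) ↔
      ∀ i j : Fin (D + 1), (i : ℕ) = (j : ℕ) + 1 →
        c i / c j = -a⁻¹ * q ^ ((D : ℤ) - 2 * (i : ℤ) + 1) := by
  refine forall₃_congr fun i j hij => ?_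
  have : (i : ℤ) = (j : ℤ) + 1 := by omega
  rw [this, vartheta_ratio_up hq0 hq1 hq2]

/-- The product telescopes, since $(n+1)(D-n-1)=n(D-n)+(D-2(n+1)+1)$. -/
lemma ratio_iff_closed_form (hq0 : q ≠ 0) (ha : a ≠ 0) {D : ℕ} (c : Fin (D + 1) → ℂ)
    (hc : ∀ i, c i ≠ 0) :
    (∀ i j : Fin (D + 1), (i : ℕ) = (j : ℕ) + 1 →
        c i / c j = -a⁻¹ * q ^ ((D : ℤ) - 2 * (i : ℤ) + 1)) ↔
      ∀ i : Fin (D + 1),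
        c i = c 0 * (-1) ^ (i : ℕ) * a ^ (-(i : ℤ)) * q ^ ((i : ℤ) * ((D : ℤ) - (i : ℤ))) := by
  have step : ∀ n : ℕ,
      c 0 * (-1) ^ (n + 1) * a ^ (-((n + 1 : ℕ) : ℤ)) *
          q ^ (((n + 1 : ℕ) : ℤ) * ((D : ℤ) - ((n + 1 : ℕ) : ℤ))) =
        -a⁻¹ * q ^ ((D : ℤ) - 2 * ((n + 1 : ℕ) : ℤ) + 1) *
          (c 0 * (-1) ^ n * a ^ (-(n : ℤ)) * q ^ ((n : ℤ) * ((D : ℤ) - (n : ℤ)))) := by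
    intro n
    have e1 : a ^ (-((n + 1 : ℕ) : ℤ)) = a ^ (-(n : ℤ)) * a⁻¹ := by
      rw [← zpow_neg_one a, ← zpow_add₀ ha]; congr 1; push_cast; ring
    have e2 : q ^ (((n + 1 : ℕ) : ℤ) * ((D : ℤ) - ((n + 1 : ℕ) : ℤ))) =
        q ^ ((D : ℤ) - 2 * ((n + 1 : ℕ) : ℤ) + 1) * q ^ ((n : ℤ) * ((D : ℤ) - (n : ℤ))) := by
      rw [← zpow_add₀ hq0]; congr 1; push_cast; ring
    rw [e1, e2]; ring
  constructor
  · intro h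
    have key : ∀ (n : ℕ) (hn : n < D + 1), c ⟨n, hn⟩ =
        c 0 * (-1) ^ n * a ^ (-(n : ℤ)) * q ^ ((n : ℤ) * ((D : ℤ) - (n : ℤ))) := by
      intro n
      induction n with
      | zero => intro hn; simp
      | succ n ih =>
        intro hn
        rw [step, ← ih (by omega)]
        exact (div_eq_iff (hc _)).1 (h ⟨n + 1, hn⟩ ⟨n, by omega⟩ rfl)
    exact fun i => key i i.2
  · intro h i j hij
    rw [div_eq_iff (hc j), h i, h j, hij]
    exact step j

/-- The equivalent descriptions of the coefficients of an invertible element. -/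
lemma tfae_of_iff_ratio (hq0 : q ≠ 0) (hq1 : q ^ 2 ≠ 1) (hq2 : q ^ 2 ≠ -1) (ha : a ≠ 0)
    {D : ℕ} (c : Fin (D + 1) → ℂ) (hc : ∀ i, c i ≠ 0) {p r : Prop}
    (hr : r ↔ ∀ i j : Fin (D + 1), |(i : ℤ) - (j : ℤ)| = 1 →
      c i / c j = (q⁻¹ * vartheta a q D i - q * vartheta a q D j) / (q ^ 2 - q ^ (-2 : ℤ)))
    (hp : p ↔ r) :
    List.TFAE [p, r,
      ∀ i j : Fin (D + 1), (i : ℕ) = (j : ℕ) + 1 →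
        c i / c j =
          (q⁻¹ * vartheta a q D i - q * vartheta a q D j) / (q ^ 2 - q ^ (-2 : ℤ)),
      ∀ i j : Fin (D + 1), (i : ℕ) = (j : ℕ) + 1 →
        c i / c j = -a⁻¹ * q ^ ((D : ℤ) - 2 * (i : ℤ) + 1),
      ∀ i : Fin (D + 1),
        c i = c 0 * (-1) ^ (i : ℕ) * a ^ (-(i : ℤ)) *
          q ^ ((i : ℤ) * ((D : ℤ) - (i : ℤ)))] := by
  have h1 := hr.trans (ratio_adjacent_iff hq0 hq1 hq2 ha c)
  have h2 := ratio_vartheta_iff (a := a) hq0 hq1 hq2 c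
  have h3 := ratio_iff_closed_form (a := a) hq0 ha c hc
  tfae_have 1 ↔ 2 := hp
  tfae_have 2 ↔ 3 := h1
  tfae_have 3 ↔ 4 := h2
  tfae_have 4 ↔ 5 := h3
  tfae_finish

end Scalars

/-! ### Block decomposition along complete orthogonal idempotents. -/

section Idempotents

variable {X ι : Type*} [Fintype X] [DecidableEq X] [Fintype ι] [DecidableEq ι]
  {F : ι → Matrix X X ℂ}

lemma mul_sum_smul (hF : OrthogonalIdempotents F) (t : ι → ℂ) (i : ι) :
    F i * ∑ j, t j • F j = t i • F i := by
  simp [Finset.mul_sum, hF.mul_eq]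

lemma sum_smul_mul (hF : OrthogonalIdempotents F) (t : ι → ℂ) (i : ι) :
    (∑ j, t j • F j) * F i = t i • F i := by
  simp [Finset.sum_mul, hF.mul_eq]

lemma sum_smul_mul_sum_smul (hF : OrthogonalIdempotents F) (s t : ι → ℂ) :
    (∑ i, s i • F i) * ∑ j, t j • F j = ∑ i, (s i * t i) • F i := by
  simp [Finset.sum_mul, mul_sum_smul hF, smul_smul]

lemma inv_sum_smul (hF : CompleteOrthogonalIdempotents F) {c : ι → ℂ} (hc : ∀ i, c i ≠ 0) :
    (∑ i, c i • F i)⁻¹ = ∑ i, (c i)⁻¹ • F i := by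
  apply Matrix.inv_eq_right_inv
  rw [sum_smul_mul_sum_smul hF.toOrthogonalIdempotents]
  simp [hc, hF.complete]

lemma coeff_ne_zero_of_isUnit (hF : OrthogonalIdempotents F) (hF0 : ∀ i, F i ≠ 0)
    {c : ι → ℂ} (hW : IsUnit (∑ i, c i • F i)) (i : ι) : c i ≠ 0 := by
  intro h
  have := sum_smul_mul hF c i
  rw [h, zero_smul] at this
  exact hF0 i (hW.mul_right_eq_zero.1 this)

lemma eq_iff_blocks (hF : CompleteOrthogonalIdempotents F) (S T : Matrix X X ℂ) :
    S = T ↔ ∀ i j, F i * S * F j = F i * T * F j := by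
  refine ⟨fun h i j => by rw [h], fun h => ?_⟩
  have key : ∀ S : Matrix X X ℂ, S = ∑ i, ∑ j, F i * S * F j := fun S => by
    simp_rw [← Finset.mul_sum, ← Finset.sum_mul, hF.complete, one_mul, mul_one]
  rw [key S, key T]
  simp_rw [h]

/-- A twisted commutator with prescribed diagonal blocks is a conjugate of `T` by an element
of the span of the idempotents exactly when the coefficients have prescribed ratios. -/
lemma conj_eq_iff (hF : CompleteOrthogonalIdempotents F) (T : Matrix X X ℂ) (t c : ι → ℂ)
    (hc : ∀ i, c i ≠ 0) (u v : ℂ) (N : ι → ι → Prop) (hN : ∀ i j, N i j → i ≠ j)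
    (hT : ∀ i j, i ≠ j → (F i * T * F j ≠ 0 ↔ N i j)) :
    (∑ i, (c i)⁻¹ • F i) * T * (∑ i, c i • F i) =
        (∑ i, (1 + (u - v) * t i) • (F i * T * F i)) -
          (u • ((∑ i, t i • F i) * T) - v • (T * ∑ i, t i • F i)) ↔
      ∀ i j, N i j → c j / c i = v * t j - u * t i := by
  have hO := hF.toOrthogonalIdempotents
  have hL : ∀ i j, F i * ((∑ i, (c i)⁻¹ • F i) * T * (∑ i, c i • F i)) * F j =
      (c j / c i) • (F i * T * F j) := by
    intro i j
    rw [← mul_assoc, ← mul_assoc, mul_sum_smul hO, mul_assoc, sum_smul_mul hO,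
      mul_smul_comm, smul_mul_assoc, smul_mul_assoc, smul_smul, div_eq_mul_inv]
  -- On the diagonal, $1+(u-v)t_i$ is reduced by $ut_i-vt_i$ to exactly $1=c_i/c_i$, so diagonal
  -- blocks impose no condition.
  have hR : ∀ i j, F i * ((∑ i, (1 + (u - v) * t i) • (F i * T * F i)) -
      (u • ((∑ i, t i • F i) * T) - v • (T * ∑ i, t i • F i))) * F j =
      (if i = j then 1 else v * t j - u * t i) • (F i * T * F j) := by
    intro i j
    have e1 : F i * (∑ k, (1 + (u - v) * t k) • (F k * T * F k)) * F j =
        (if i = j then 1 + (u - v) * t i else 0) • (F i * T * F j) := by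
      have e : ∀ k, F i * ((1 + (u - v) * t k) • (F k * T * F k)) * F j =
          if i = k then (if i = j then 1 + (u - v) * t i else 0) • (F i * T * F j) else 0 := by
        intro k
        have : F i * (F k * T * F k) * F j = (F i * F k) * T * (F k * F j) := by
          simp only [mul_assoc]
        rw [mul_smul_comm, smul_mul_assoc, this, hO.mul_eq, hO.mul_eq]
        by_cases hik : i = k
        · subst hik
          by_cases hij : i = j
          · subst hij; simp
          · simp [hij]
        · simp [hik]
      rw [Finset.mul_sum, Finset.sum_mul, Finset.sum_congr rfl fun k _ => e k]
      simp
    have e2 : F i * ((∑ k, t k • F k) * T) * F j = t i • (F i * T * F j) := by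
      rw [← mul_assoc, mul_sum_smul hO, smul_mul_assoc, smul_mul_assoc]
    have e3 : F i * (T * ∑ k, t k • F k) * F j = t j • (F i * T * F j) := by
      rw [mul_assoc, mul_assoc, sum_smul_mul hO, mul_smul_comm, mul_smul_comm, mul_assoc]
    rw [mul_sub, sub_mul, mul_sub, sub_mul, mul_smul_comm, smul_mul_assoc, mul_smul_comm,
      smul_mul_assoc, e1, e2, e3, smul_smul, smul_smul, ← sub_smul, ← sub_smul]
    split_ifs with h
    · subst h; congr 1; ring
    · congr 1; ring
  rw [eq_iff_blocks hF]
  simp_rw [hL, hR]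
  constructor
  · intro h i j hij
    have hne := hN i j hij
    have := h i j
    rw [if_neg hne] at this
    exact smul_left_injective ℂ ((hT i j hne).2 hij) this
  · intro h i j
    by_cases hij : i = j
    · subst hij; simp [hc]
    · rw [if_neg hij]
      by_cases h0 : F i * T * F j = 0
      · simp [h0]
      · rw [h i j ((hT i j hij).1 h0)]

end Idempotents

/-! ### Distances and intersection numbers. -/

section Graph

variable {X : Type*} {G : SimpleGraph X}

lemma exists_adj_dist_eq (hG : G.Connected) {x y : X} {n : ℕ} (h : G.dist x y = n + 1) :
    ∃ z, G.Adj z y ∧ G.dist x z = n := by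
  -- The geodesic is taken from $y$ to $x$, so that its first edge leads to the required neighbour
  -- of $y$.
  obtain ⟨p, hp⟩ := hG.exists_walk_length_eq_dist y x
  rw [G.dist_comm, h] at hp
  cases p with
  | nil => simp at hp
  | cons hadj p' =>
    rename_i z
    refine ⟨z, hadj.symm, ?_⟩
    have h1 : G.dist z x ≤ p'.length := SimpleGraph.dist_le p'
    have h2 : G.dist y x ≤ G.dist y z + G.dist z x := hG.dist_triangle
    have h3 : G.dist y z = 1 := SimpleGraph.dist_eq_one_iff_adj.2 hadj
    have h4 : G.dist y x = n + 1 := by rw [G.dist_comm, h]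
    have h5 : p'.length + 1 = n + 1 := by simpa using hp
    rw [G.dist_comm]
    omega

lemma exists_dist_eq_of_le (hG : G.Connected) {x : X} {n m : ℕ} (hmn : m ≤ n)
    (h : ∃ y, G.dist x y = n) : ∃ y, G.dist x y = m := by
  induction n with
  | zero => obtain rfl : m = 0 := by omega
            exact h
  | succ n ih =>
    rcases Nat.lt_or_ge n m with h1 | h1
    · obtain rfl : m = n + 1 := by omega
      exact h
    · obtain ⟨y, hy⟩ := h
      obtain ⟨z, -, hz⟩ := exists_adj_dist_eq hG hy
      exact ih h1 ⟨z, hz⟩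

variable [Fintype X]

lemma dist_lt (hG : G.Connected) {D : ℕ} (hdiam : G.diam = D) (y z : X) :
    G.dist y z < D + 1 := by
  have := hG.nonempty
  have : G.ediam ≠ ⊤ := SimpleGraph.connected_iff_ediam_ne_top.1 hG
  have := SimpleGraph.dist_le_diam this (u := y) (v := z)
  omega

/-- Every vertex has eccentricity $D$: the number $p^0_{D,D}$ of vertices at distance $D$ is the
same at all vertices, and positive at an end of a diametral pair. -/
lemma exists_dist_eq (hG : IsDistanceRegular G) {D : ℕ} (hdiam : G.diam = D) (x : X)
    {n : ℕ} (hn : n ≤ D) : ∃ y, G.dist x y = n := by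
  have : Nonempty X := ⟨x⟩
  refine exists_dist_eq_of_le hG.connected hn ?_
  obtain ⟨u, v, huv⟩ := G.exists_dist_eq_diam
  obtain ⟨p, hp⟩ := hG.exists_intersection_numbers
  have hu := hp 0 D D u u (by simp)
  have hx := hp 0 D D x x (by simp)
  have hpos : 0 < (Finset.univ.filter fun w : X => G.dist x w = D ∧ G.dist x w = D).card := by
    rw [hx, ← hu]
    exact Finset.card_pos.2 ⟨v, by simp [huv, hdiam]⟩
  obtain ⟨w, hw⟩ := Finset.card_pos.1 hpos
  exact ⟨w, (Finset.mem_filter.1 hw).2.1⟩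

/-- Vertices at distances `i` and `j` from `x` can be adjacent, for `i ≠ j`, exactly when
`|i - j| = 1`. -/
lemma exists_adj_dist_dist_iff (hG : IsDistanceRegular G) {D : ℕ} (hdiam : G.diam = D) (x : X)
    {i j : ℕ} (hi : i ≤ D) (hj : j ≤ D) (hij : i ≠ j) :
    (∃ y z, G.Adj y z ∧ G.dist x y = i ∧ G.dist x z = j) ↔ |(i : ℤ) - (j : ℤ)| = 1 := by
  constructor
  · rintro ⟨y, z, hyz, rfl, rfl⟩
    have h1 := SimpleGraph.dist_eq_one_iff_adj.2 hyz
    have h2 : G.dist x z ≤ G.dist x y + G.dist y z := hG.connected.dist_triangle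
    have h3 : G.dist x y ≤ G.dist x z + G.dist z y := hG.connected.dist_triangle
    rw [G.dist_comm (u := z)] at h3
    rw [abs_eq zero_le_one]
    omega
  · intro h
    rcases (abs_eq zero_le_one).1 h with h1 | h1
    · obtain rfl : i = j + 1 := by omega
      obtain ⟨y, hy⟩ := exists_dist_eq hG hdiam x hi
      obtain ⟨z, hz, hz'⟩ := exists_adj_dist_eq hG.connected hy
      exact ⟨y, z, hz.symm, hy, hz'⟩
    · obtain rfl : j = i + 1 := by omega
      obtain ⟨y, hy⟩ := exists_dist_eq hG hdiam x hj
      obtain ⟨z, hz, hz'⟩ := exists_adj_dist_eq hG.connected hy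
      exact ⟨z, y, hz, hz', hy⟩

/-- The intersection number `p^1_{i,j}` with `i ≠ j` is nonzero exactly when `|i - j| = 1`. -/
lemma intersection_number_one_ne_zero_iff (hG : IsDistanceRegular G) {D : ℕ}
    (hdiam : G.diam = D) (x : X) {p : ℕ → ℕ → ℕ → ℕ}
    (hp : ∀ (h i j : ℕ) (y z : X), G.dist y z = h →
      (Finset.univ.filter fun w : X => G.dist y w = i ∧ G.dist z w = j).card = p h i j)
    {i j : ℕ} (hi : i ≤ D) (hj : j ≤ D) (hij : i ≠ j) (hD : 1 ≤ D) :
    p 1 i j ≠ 0 ↔ |(i : ℤ) - (j : ℤ)| = 1 := by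
  constructor
  · intro h
    obtain ⟨y, hy⟩ := exists_dist_eq hG hdiam x hD
    rw [← hp 1 i j x y hy] at h
    obtain ⟨w, hw⟩ := Finset.card_pos.1 (Nat.pos_of_ne_zero h)
    obtain ⟨-, h1, h2⟩ := Finset.mem_filter.1 hw
    -- The vertex $w$ counted by $p^1_{i,j}$ becomes the base vertex from which the edge $xy$ is
    -- seen.
    refine (exists_adj_dist_dist_iff hG hdiam w hi hj hij).1
      ⟨x, y, SimpleGraph.dist_eq_one_iff_adj.1 hy, ?_, ?_⟩
    · rw [G.dist_comm, h1]
    · rw [G.dist_comm, h2]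
  · intro h
    obtain ⟨y, z, hyz, h1, h2⟩ := (exists_adj_dist_dist_iff hG hdiam x hi hj hij).2 h
    rw [← hp 1 i j y z (SimpleGraph.dist_eq_one_iff_adj.2 hyz)]
    refine (Finset.card_pos.2 ⟨x, ?_⟩).ne'
    simp [G.dist_comm, h1, h2]

lemma sum_smul_distanceMatrix_apply (hG : G.Connected) {D : ℕ} (hdiam : G.diam = D)
    (f : ℕ → ℂ) (y z : X) :
    (∑ i : Fin (D + 1), f i • distanceMatrix G i) y z = f (G.dist y z) := by
  have hlt := dist_lt hG hdiam y z
  rw [Matrix.sum_apply, Finset.sum_eq_single (⟨G.dist y z, hlt⟩ : Fin (D + 1))]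
  · simp [distanceMatrix]
  · intro i _ hi
    have : G.dist y z ≠ i := fun h => hi (Fin.ext h.symm)
    simp [distanceMatrix, this]
  · simp

lemma distanceMatrix_mul (hG : G.Connected) {D : ℕ} (hdiam : G.diam = D)
    {p : ℕ → ℕ → ℕ → ℕ}
    (hp : ∀ (h i j : ℕ) (y z : X), G.dist y z = h →
      (Finset.univ.filter fun w : X => G.dist y w = i ∧ G.dist z w = j).card = p h i j)
    (i j : ℕ) :
    distanceMatrix G i * distanceMatrix G j =
      ∑ h : Fin (D + 1), (p h i j : ℂ) • distanceMatrix G h := by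
  ext y z
  rw [sum_smul_distanceMatrix_apply hG hdiam (fun h => (p h i j : ℂ)), ← hp _ i j y z rfl,
    Matrix.mul_apply, Finset.card_filter, Nat.cast_sum]
  refine Finset.sum_congr rfl fun w _ => ?_
  simp only [distanceMatrix, Matrix.of_apply, G.dist_comm (u := w) (v := z)]
  by_cases h1 : G.dist y w = i <;> by_cases h2 : G.dist z w = j <;> simp [h1, h2]

end Graph

/-! ### The dual idempotents and the blocks $E^*_iA_1E^*_j$. -/

section DualIdempotents

variable {X : Type*} [Fintype X] [DecidableEq X] {G : SimpleGraph X}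

lemma sum_smul_dualIdempotent (hG : G.Connected) {D : ℕ} (hdiam : G.diam = D) (x : X)
    (f : ℕ → ℂ) :
    ∑ i : Fin (D + 1), f i • dualIdempotent G x i =
      Matrix.diagonal fun y => f (G.dist x y) := by
  ext y z
  rw [Matrix.sum_apply]
  by_cases hyz : y = z
  · subst hyz
    have hlt := dist_lt hG hdiam x y
    rw [Finset.sum_eq_single (⟨G.dist x y, hlt⟩ : Fin (D + 1))]
    · simp [dualIdempotent]
    · intro i _ hi
      have : G.dist x y ≠ i := fun h => hi (Fin.ext h.symm)
      simp [dualIdempotent, this]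
    · simp
  · simp [dualIdempotent, hyz]

lemma completeOrthogonalIdempotents_dualIdempotent (hG : G.Connected) {D : ℕ}
    (hdiam : G.diam = D) (x : X) :
    CompleteOrthogonalIdempotents fun i : Fin (D + 1) => dualIdempotent G x i where
  idem i := by
    simp [IsIdempotentElem, dualIdempotent, Matrix.diagonal_mul_diagonal]
  ortho i j hij := by
    have hij' : (i : ℕ) ≠ j := fun h => hij (Fin.ext h)
    simp only [dualIdempotent, Matrix.diagonal_mul_diagonal]
    rw [← Matrix.diagonal_zero]
    congr 1
    ext y
    by_cases h : G.dist x y = i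
    · simp [h, hij']
    · simp [h]
  complete := by
    have := sum_smul_dualIdempotent hG hdiam x fun _ => 1
    simpa using this

lemma dualIdempotent_mul_mul_apply (x : X) (i j : ℕ) (T : Matrix X X ℂ) (y z : X) :
    (dualIdempotent G x i * T * dualIdempotent G x j) y z =
      if G.dist x y = i ∧ G.dist x z = j then T y z else 0 := by
  simp only [dualIdempotent, Matrix.mul_diagonal, Matrix.diagonal_mul]
  by_cases h1 : G.dist x y = i <;> by_cases h2 : G.dist x z = j <;> simp [h1, h2]

lemma dualIdempotent_ne_zero (hG : IsDistanceRegular G) {D : ℕ} (hdiam : G.diam = D) (x : X)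
    {i : ℕ} (hi : i ≤ D) : dualIdempotent G x i ≠ 0 := by
  obtain ⟨y, hy⟩ := exists_dist_eq hG hdiam x hi
  intro h
  have := congrFun (congrFun h y) y
  simp [dualIdempotent, hy] at this

lemma dualIdempotent_mul_distanceMatrix_one_ne_zero_iff (hG : IsDistanceRegular G) {D : ℕ}
    (hdiam : G.diam = D) (x : X) {i j : ℕ} (hi : i ≤ D) (hj : j ≤ D) (hij : i ≠ j) :
    dualIdempotent G x i * distanceMatrix G 1 * dualIdempotent G x j ≠ 0 ↔
      |(i : ℤ) - (j : ℤ)| = 1 := by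
  rw [← exists_adj_dist_dist_iff hG hdiam x hi hj hij]
  constructor
  · intro h
    by_contra hne
    apply h
    ext y z
    rw [dualIdempotent_mul_mul_apply]
    by_cases h1 : G.dist x y = i ∧ G.dist x z = j
    · have : ¬ G.dist y z = 1 := fun h =>
        hne ⟨y, z, SimpleGraph.dist_eq_one_iff_adj.1 h, h1⟩
      simp [distanceMatrix, this]
    · simp [h1]
  · rintro ⟨y, z, hyz, h1, h2⟩ h
    have := congrFun (congrFun h y) z
    rw [dualIdempotent_mul_mul_apply] at this
    simp [h1, h2, distanceMatrix, SimpleGraph.dist_eq_one_iff_adj.2 hyz] at this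

end DualIdempotents

/-! ### The primitive idempotents and the blocks $E_iA^*_hE_j$. -/

section PrimitiveIdempotents

variable {X : Type*} [Fintype X] [DecidableEq X] {G : SimpleGraph X} {D : ℕ}
  {E : Fin (D + 1) → Matrix X X ℂ} {P Q : Matrix (Fin (D + 1)) (Fin (D + 1)) ℂ}

lemma idempotent_apply (hG : G.Connected) (hdiam : G.diam = D)
    (hQ : IsSecondEigenmatrix G E Q) (j : Fin (D + 1)) (y z : X) :
    E j y z = (Fintype.card X : ℂ)⁻¹ * Q ⟨G.dist y z, dist_lt hG hdiam y z⟩ j := by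
  -- The column of $Q$ is extended by $0$ beyond $D$, a value never reached by a distance.
  have := sum_smul_distanceMatrix_apply hG hdiam
    (fun n => if h : n < D + 1 then Q ⟨n, h⟩ j else 0) y z
  simp only [Fin.is_lt, dist_lt hG hdiam y z, dite_true, Fin.eta] at this
  rw [hQ j, Matrix.smul_apply, this, smul_eq_mul]

lemma distanceMatrix_mul_idempotent (hE : IsPrimitiveIdempotentOrdering G E)
    (hP : IsFirstEigenmatrix G E P) (h j : Fin (D + 1)) :
    distanceMatrix G h * E j = P j h • E j := by
  rw [hP h, sum_smul_mul hE.complete.toOrthogonalIdempotents (fun i => P i h)]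

/-- $E_i^H$ is a combination of the real symmetric $A_h$, so it acts on each $E_j$ as a scalar. For
$j\ne i$ that scalar is $0$, because $E_j^HE_i^HE_j=(E_iE_j)^HE_j=0$ while $E_j^HE_j\ne0$. Hence
$E_i^H=E_i^HE_i$, which is Hermitian. -/
lemma idempotent_isHermitian (hE : IsPrimitiveIdempotentOrdering G E)
    (hP : IsFirstEigenmatrix G E P) (hQ : IsSecondEigenmatrix G E Q) (i : Fin (D + 1)) :
    (E i)ᴴ = E i := by
  have hO := hE.complete.toOrthogonalIdempotents
  have hA : ∀ h : ℕ, (distanceMatrix G h)ᴴ = distanceMatrix G h := by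
    intro h
    ext y z
    simp only [Matrix.conjTranspose_apply, distanceMatrix, Matrix.of_apply, G.dist_comm (u := z)]
    split_ifs <;> simp
  have hscal : ∀ j, ∃ l : ℂ, (E i)ᴴ * E j = l • E j := by
    intro j
    refine ⟨(Fintype.card X : ℂ)⁻¹ * ∑ h, star (Q h i) * P j h, ?_⟩
    conv_lhs => rw [hQ i]
    simp only [Matrix.conjTranspose_smul, Matrix.conjTranspose_sum, hA, smul_mul_assoc,
      Finset.sum_mul, distanceMatrix_mul_idempotent hE hP, smul_smul]
    rw [← Finset.sum_smul, smul_smul]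
    simp
  have hzero : ∀ j, j ≠ i → (E i)ᴴ * E j = 0 := by
    intro j hj
    obtain ⟨l, hl⟩ := hscal j
    have h1 : (E j)ᴴ * ((E i)ᴴ * E j) = 0 := by
      rw [← mul_assoc, ← Matrix.conjTranspose_mul, hO.ortho hj.symm]
      simp
    rw [hl, mul_smul_comm, smul_eq_zero, Matrix.conjTranspose_mul_self_eq_zero] at h1
    rcases h1 with h1 | h1
    · rw [hl, h1, zero_smul]
    · exact absurd h1 (hE.linearIndependent.ne_zero j)
  have hself : (E i)ᴴ = (E i)ᴴ * E i := by
    conv_lhs => rw [← mul_one (E i)ᴴ, ← hE.complete.complete, Finset.mul_sum]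
    exact Finset.sum_eq_single i (fun j _ hj => hzero j hj) (by simp)
  have h2 := congrArg Matrix.conjTranspose hself
  rw [Matrix.conjTranspose_mul, Matrix.conjTranspose_conjTranspose] at h2
  rw [hself, ← h2]

lemma idempotent_apply_comm (hG : G.Connected) (hdiam : G.diam = D)
    (hQ : IsSecondEigenmatrix G E Q) (j : Fin (D + 1)) (y z : X) : E j y z = E j z y := by
  rw [idempotent_apply hG hdiam hQ, idempotent_apply hG hdiam hQ]
  simp only [G.dist_comm (u := y)]

/-- Both sides are the eigenvalue of $A_iA_j$ on $E_k$. -/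
lemma eigenmatrix_mul (hG : G.Connected) (hdiam : G.diam = D)
    (hE : IsPrimitiveIdempotentOrdering G E) (hP : IsFirstEigenmatrix G E P)
    {p : ℕ → ℕ → ℕ → ℕ}
    (hp : ∀ (h i j : ℕ) (y z : X), G.dist y z = h →
      (Finset.univ.filter fun w : X => G.dist y w = i ∧ G.dist z w = j).card = p h i j)
    (i j k : Fin (D + 1)) :
    P k i * P k j = ∑ h : Fin (D + 1), (p h i j : ℂ) * P k h := by
  have h1 := congrArg (· * E k) (distanceMatrix_mul hG hdiam hp i j)
  simp only [mul_assoc, Finset.sum_mul, smul_mul_assoc, distanceMatrix_mul_idempotent hE hP,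
    mul_smul_comm, smul_smul] at h1
  rw [← Finset.sum_smul] at h1
  rw [mul_comm]
  exact smul_left_injective ℂ (hE.linearIndependent.ne_zero k) h1

/-- Under formal self-duality, the Krein parameters are the intersection numbers. -/
lemma idempotent_entrywise_mul (hG : G.Connected) (hdiam : G.diam = D)
    (hE : IsPrimitiveIdempotentOrdering G E) (hP : IsFirstEigenmatrix G E P)
    (hQ : IsSecondEigenmatrix G E P) {p : ℕ → ℕ → ℕ → ℕ}
    (hp : ∀ (h i j : ℕ) (y z : X), G.dist y z = h →
      (Finset.univ.filter fun w : X => G.dist y w = i ∧ G.dist z w = j).card = p h i j)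
    (i j : Fin (D + 1)) (y z : X) :
    E i y z * E j y z =
      (Fintype.card X : ℂ)⁻¹ * (∑ h : Fin (D + 1), (p h i j : ℂ) • E h) y z := by
  simp only [Matrix.sum_apply, Matrix.smul_apply, smul_eq_mul, idempotent_apply hG hdiam hQ]
  -- Self-duality enters here: the entries of the idempotents are, up to $|X|^{-1}$, entries of $P$
  -- itself, and so obey its product rule.
  rw [mul_mul_mul_comm, eigenmatrix_mul hG hdiam hE hP hp, mul_assoc, Finset.mul_sum,
    Finset.mul_sum, Finset.mul_sum]
  refine Finset.sum_congr rfl fun h _ => ?_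
  ring

/-- The diagonal of $E_i$ is constant, so a zero entry would give
$\mathrm{tr}(E_iE_i^H)=\mathrm{tr}\,E_i=0$. -/
lemma idempotent_diag_ne_zero (hG : G.Connected) (hdiam : G.diam = D)
    (hE : IsPrimitiveIdempotentOrdering G E) (hP : IsFirstEigenmatrix G E P)
    (hQ : IsSecondEigenmatrix G E Q) (i : Fin (D + 1)) (x : X) : E i x x ≠ 0 := by
  intro h
  apply hE.linearIndependent.ne_zero i
  rw [← Matrix.trace_mul_conjTranspose_self_eq_zero_iff, idempotent_isHermitian hE hP hQ,
    (hE.complete.idem i).eq]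
  refine Finset.sum_eq_zero fun y _ => ?_
  rw [Matrix.diag_apply, ← h, idempotent_apply hG hdiam hQ, idempotent_apply hG hdiam hQ]
  simp only [SimpleGraph.dist_self]

/-- The triple product relation `E_i A^*_h E_j = 0` if and only if `p^h_{i,j} = 0`. -/
lemma idempotent_mul_dualDistanceMatrix_ne_zero_iff (hG : G.Connected) (hdiam : G.diam = D)
    (hE : IsPrimitiveIdempotentOrdering G E) (hP : IsFirstEigenmatrix G E P)
    (hQ : IsSecondEigenmatrix G E P) {p : ℕ → ℕ → ℕ → ℕ}
    (hp : ∀ (h i j : ℕ) (y z : X), G.dist y z = h →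
      (Finset.univ.filter fun w : X => G.dist y w = i ∧ G.dist z w = j).card = p h i j)
    (x : X) (h i j : Fin (D + 1)) :
    E i * dualDistanceMatrix E x h * E j ≠ 0 ↔ p h i j ≠ 0 := by
  have hO := hE.complete.toOrthogonalIdempotents
  have : Nonempty X := ⟨x⟩
  have hcard : (Fintype.card X : ℂ) ≠ 0 := Nat.cast_ne_zero.2 Fintype.card_ne_zero
  have hH := idempotent_isHermitian hE hP hQ
  have hS := idempotent_apply_comm hG hdiam hQ
  have hAH : (dualDistanceMatrix E x h)ᴴ = dualDistanceMatrix E x h := by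
    rw [dualDistanceMatrix, Matrix.diagonal_conjTranspose]
    congr 1
    ext y
    have := congrFun (congrFun (hH h) x) y
    rw [Matrix.conjTranspose_apply, hS h y x] at this
    simp only [Pi.star_apply, star_mul', this]
    simp
  -- The squared Frobenius norm of the block is $\mathrm{tr}(E_iA^*_hE_jA^*_h)=|X|(E_hKE_h)_{x,x}$,
  -- where $K=\sum_kp^k_{i,j}E_k$ is $|X|$ times the entrywise product of $E_i$ and $E_j$.
  have htr : (E i * dualDistanceMatrix E x h * E j *
      (E i * dualDistanceMatrix E x h * E j)ᴴ).trace =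
      (Fintype.card X : ℂ) * ((p h i j : ℂ) * E h x x) := by
    have e1 : (E i * dualDistanceMatrix E x h * E j *
        (E i * dualDistanceMatrix E x h * E j)ᴴ).trace =
        (E i * dualDistanceMatrix E x h * (E j * dualDistanceMatrix E x h)).trace := by
      calc (E i * dualDistanceMatrix E x h * E j *
            (E i * dualDistanceMatrix E x h * E j)ᴴ).trace
          = (E i * dualDistanceMatrix E x h * (E j * E j) * dualDistanceMatrix E x h *
              E i).trace := by
            simp only [Matrix.conjTranspose_mul, hH, hAH, mul_assoc]
        _ = (E i * E i * dualDistanceMatrix E x h * (E j * E j) *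
              dualDistanceMatrix E x h).trace := by
            rw [Matrix.trace_mul_comm]
            simp only [mul_assoc]
        _ = _ := by
            rw [(hO.idem i).eq, (hO.idem j).eq, mul_assoc _ (E j)]
    have e2 : (E i * dualDistanceMatrix E x h * (E j * dualDistanceMatrix E x h)).trace =
        (Fintype.card X : ℂ) *
          (E h * (∑ k : Fin (D + 1), (p k i j : ℂ) • E k) * E h) x x := by
      have hK : ∀ y z, (∑ k : Fin (D + 1), (p k i j : ℂ) • E k) y z =
          Fintype.card X * (E i y z * E j y z) := fun y z => by
        rw [idempotent_entrywise_mul hG hdiam hE hP hQ hp, mul_inv_cancel_left₀ hcard]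
      have hl : ∀ y z, (E i * dualDistanceMatrix E x h) y z =
          E i y z * (Fintype.card X * E h x z) := fun y z => Matrix.mul_diagonal _ _ _ _
      have hr : ∀ y z, (E j * dualDistanceMatrix E x h) y z =
          E j y z * (Fintype.card X * E h x z) := fun y z => Matrix.mul_diagonal _ _ _ _
      generalize (∑ k : Fin (D + 1), (p k i j : ℂ) • E k) = K at hK ⊢
      rw [Matrix.trace_mul_comm]
      simp only [Matrix.trace, Matrix.diag_apply, Matrix.mul_apply (M := E j * _), hl, hr,
        Matrix.mul_apply (N := E h), Matrix.mul_apply (M := E h), hK, Finset.mul_sum,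
        Finset.sum_mul]
      refine Finset.sum_congr rfl fun z _ => Finset.sum_congr rfl fun y _ => ?_
      rw [hS j z y, hS h z x]
      ring
    rw [e1, e2, mul_sum_smul hO (fun k => (p k i j : ℂ)), smul_mul_assoc, (hO.idem h).eq,
      Matrix.smul_apply, smul_eq_mul]
  rw [Ne, ← Matrix.trace_mul_conjTranspose_self_eq_zero_iff, htr]
  simp [hcard, idempotent_diag_ne_zero hG hdiam hE hP hQ]

end PrimitiveIdempotents

/-! ### Spectral forms of $\mathsf A$ and $\mathsf B$. -/

section Normalized

variable {X : Type*} [Fintype X] [DecidableEq X] {G : SimpleGraph X} {D : ℕ}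

lemma smul_sub_smul_one_eq_sum {F : Fin (D + 1) → Matrix X X ℂ}
    (hF : CompleteOrthogonalIdempotents F) {α : ℂ} (hα : α ≠ 0) (ε : ℂ) {S : Matrix X X ℂ}
    {s t : Fin (D + 1) → ℂ} (hS : S = ∑ i, s i • F i) (hs : ∀ i, s i = α * t i + ε) :
    α⁻¹ • (S - ε • (1 : Matrix X X ℂ)) = ∑ i, t i • F i := by
  rw [← hF.complete, hS, Finset.smul_sum, ← Finset.sum_sub_distrib, Finset.smul_sum]
  refine Finset.sum_congr rfl fun i _ => ?_
  rw [← sub_smul, smul_smul, hs]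
  congr 1
  field_simp
  ring

lemma block_smul_sub_smul_one_ne_zero_iff {F : Fin (D + 1) → Matrix X X ℂ}
    (hF : OrthogonalIdempotents F) {α : ℂ} (hα : α ≠ 0) (ε : ℂ) (T : Matrix X X ℂ)
    {i j : Fin (D + 1)} (hij : i ≠ j) :
    F i * (α⁻¹ • (T - ε • (1 : Matrix X X ℂ))) * F j ≠ 0 ↔ F i * T * F j ≠ 0 := by
  simp [mul_sub, sub_mul, hF.ortho hij, hα]

lemma dualDistanceMatrix_eq_sum (hG : G.Connected) (hdiam : G.diam = D)
    {E : Fin (D + 1) → Matrix X X ℂ} {Q : Matrix (Fin (D + 1)) (Fin (D + 1)) ℂ}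
    (hQ : IsSecondEigenmatrix G E Q) (x : X) (j : Fin (D + 1)) :
    dualDistanceMatrix E x j = ∑ i : Fin (D + 1), Q i j • dualIdempotent G x i := by
  have : Nonempty X := ⟨x⟩
  have hcard : (Fintype.card X : ℂ) ≠ 0 := Nat.cast_ne_zero.2 Fintype.card_ne_zero
  have := sum_smul_dualIdempotent hG hdiam x
    (fun n => if h : n < D + 1 then Q ⟨n, h⟩ j else 0)
  simp only [Fin.is_lt, dist_lt hG hdiam, dite_true, Fin.eta] at this
  rw [this, dualDistanceMatrix]
  congr 1
  ext y
  rw [idempotent_apply hG hdiam hQ, mul_inv_cancel_left₀ hcard]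

end Normalized

end DRG


/-! ### The two equivalences. -/

theorem proposition9p4 {X : Type*} [Fintype X] [DecidableEq X]
    (G : SimpleGraph X) (hG : DRG.IsDistanceRegular G)
    (D : ℕ) (hdiam : G.diam = D) (hD : 3 ≤ D)
    -- an ordering of the primitive idempotents, with its two eigenmatrices
    (E : Fin (D + 1) → Matrix X X ℂ) (hE : DRG.IsPrimitiveIdempotentOrdering G E)
    (P Q : Matrix (Fin (D + 1)) (Fin (D + 1)) ℂ)
    (hP : DRG.IsFirstEigenmatrix G E P) (hQ : DRG.IsSecondEigenmatrix G E Q)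
    -- formal self-duality
    (hPQ : P = Q)
    -- q-Racah type; here `P i 1 = θ_i` and `Q i 1 = θ*_i`
    (q a α ε : ℂ) (hq0 : q ≠ 0) (hq1 : q ^ 2 ≠ 1) (hq2 : q ^ 2 ≠ -1) (ha : a ≠ 0) (hα : α ≠ 0)
    (hθ : ∀ i : Fin (D + 1), P i 1 =
      α * (a * q ^ (2 * (i : ℤ) - (D : ℤ)) + a⁻¹ * q ^ ((D : ℤ) - 2 * (i : ℤ))) + ε)
    (hθ' : ∀ i : Fin (D + 1), Q i 1 =
      α * (a * q ^ (2 * (i : ℤ) - (D : ℤ)) + a⁻¹ * q ^ ((D : ℤ) - 2 * (i : ℤ))) + ε)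
    -- the base vertex, and the normalized adjacency and dual adjacency matrices
    (x : X) (A B : Matrix X X ℂ)
    (hA : A = α⁻¹ • (DRG.distanceMatrix G 1 - ε • (1 : Matrix X X ℂ)))
    (hB : B = α⁻¹ • (DRG.dualDistanceMatrix E x 1 - ε • (1 : Matrix X X ℂ)))
    -- the two sums are equal, and `Z` is their common value
    (Z : Matrix X X ℂ)
    (hZ : Z = ∑ i : Fin (D + 1), (1 + (P i 1 - ε) / α * (1 / (q + q⁻¹))) •
      (DRG.dualIdempotent G x i * A * DRG.dualIdempotent G x i))
    (hZ' : Z = ∑ i : Fin (D + 1), (1 + (P i 1 - ε) / α * (1 / (q + q⁻¹))) •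
      (E i * B * E i))
    (C : Matrix X X ℂ)
    (hC : C = Z - (q ^ 2 - q ^ (-2 : ℤ))⁻¹ • (q • (A * B) - q⁻¹ • (B * A))) :
    (∀ W ∈ DRG.boseMesner G, IsUnit W →
      ∀ c : Fin (D + 1) → ℂ, W = ∑ i, c i • E i →
        List.TFAE [
          W⁻¹ * B * W = C,
          ∀ i j : Fin (D + 1), |(i : ℤ) - (j : ℤ)| = 1 →
            c j / c i = (q⁻¹ * DRG.vartheta a q D j - q * DRG.vartheta a q D i) /
              (q ^ 2 - q ^ (-2 : ℤ)),
          ∀ i j : Fin (D + 1), (i : ℕ) = (j : ℕ) + 1 →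
            c i / c j = (q⁻¹ * DRG.vartheta a q D i - q * DRG.vartheta a q D j) /
              (q ^ 2 - q ^ (-2 : ℤ)),
          ∀ i j : Fin (D + 1), (i : ℕ) = (j : ℕ) + 1 →
            c i / c j = -a⁻¹ * q ^ ((D : ℤ) - 2 * (i : ℤ) + 1),
          ∀ i : Fin (D + 1),
            c i = c 0 * (-1) ^ (i : ℕ) * a ^ (-(i : ℤ)) * q ^ ((i : ℤ) * ((D : ℤ) - (i : ℤ)))]) ∧
    (∀ W' ∈ DRG.dualBoseMesner G x, IsUnit W' →
      ∀ c : Fin (D + 1) → ℂ, W' = ∑ i : Fin (D + 1), c i • DRG.dualIdempotent G x i →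
        List.TFAE [
          W' * A * W'⁻¹ = C,
          ∀ i j : Fin (D + 1), |(i : ℤ) - (j : ℤ)| = 1 →
            c i / c j = (q⁻¹ * DRG.vartheta a q D i - q * DRG.vartheta a q D j) /
              (q ^ 2 - q ^ (-2 : ℤ)),
          ∀ i j : Fin (D + 1), (i : ℕ) = (j : ℕ) + 1 →
            c i / c j = (q⁻¹ * DRG.vartheta a q D i - q * DRG.vartheta a q D j) /
              (q ^ 2 - q ^ (-2 : ℤ)),
          ∀ i j : Fin (D + 1), (i : ℕ) = (j : ℕ) + 1 →
            c i / c j = -a⁻¹ * q ^ ((D : ℤ) - 2 * (i : ℤ) + 1),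
          ∀ i : Fin (D + 1),
            c i = c 0 * (-1) ^ (i : ℕ) * a ^ (-(i : ℤ)) * q ^ ((i : ℤ) * ((D : ℤ) - (i : ℤ)))]) := by
  subst hPQ
  obtain ⟨p, hp⟩ := hG.exists_intersection_numbers
  have hF := hE.complete
  have hF' := DRG.completeOrthogonalIdempotents_dualIdempotent hG.connected hdiam x
  -- The numeral is reduced modulo $D+1$, so this needs $D\ge1$.
  have hone : ((1 : Fin (D + 1)) : ℕ) = 1 := by
    rw [Fin.val_one', Nat.mod_eq_of_lt (by omega)]
  have hk := DRG.sq_sub_zpow_neg_two_ne_zero hq0 hq1 hq2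
  have hqq := DRG.add_inv_ne_zero hq0 hq2
  -- This is $u-v$ in `conj_eq_iff`, which must match the coefficient of $\vartheta_i$ in $Z$.
  have hkq : q * (q ^ 2 - q ^ (-2 : ℤ))⁻¹ - q⁻¹ * (q ^ 2 - q ^ (-2 : ℤ))⁻¹ =
      1 / (q + q⁻¹) := by
    have : q ^ 2 - q ^ (-2 : ℤ) = (q - q⁻¹) * (q + q⁻¹) := by
      rw [zpow_neg, ← inv_zpow]; norm_cast; ring
    rw [← sub_mul, ← div_eq_mul_inv, div_eq_div_iff hk hqq, this, one_mul]
  have hϑ : ∀ i : Fin (D + 1), P i 1 = α * DRG.vartheta a q D i + ε := hθ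
  have hcoef : ∀ i : Fin (D + 1), 1 + (P i 1 - ε) / α * (1 / (q + q⁻¹)) =
      1 + 1 / (q + q⁻¹) * DRG.vartheta a q D i := by
    intro i
    rw [hϑ, add_sub_cancel_right, mul_div_cancel_left₀ _ hα, mul_comm]
  have hAsum : A = ∑ i : Fin (D + 1), DRG.vartheta a q D i • E i := by
    rw [hA]
    refine DRG.smul_sub_smul_one_eq_sum hF hα ε ?_ hϑ
    rw [← hP 1, hone]
  have hBsum : B = ∑ i : Fin (D + 1), DRG.vartheta a q D i • DRG.dualIdempotent G x i := by
    rw [hB]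
    exact DRG.smul_sub_smul_one_eq_sum hF' hα ε
      (DRG.dualDistanceMatrix_eq_sum hG.connected hdiam hQ x 1) hϑ
  simp only [hcoef] at hZ hZ'
  constructor
  · rintro W - hW c rfl
    have hc := DRG.coeff_ne_zero_of_isUnit hF.toOrthogonalIdempotents
      hE.linearIndependent.ne_zero hW
    have hblock : ∀ i j : Fin (D + 1), i ≠ j →
        (E i * B * E j ≠ 0 ↔ |(i : ℤ) - (j : ℤ)| = 1) := by
      intro i j hij
      rw [hB, DRG.block_smul_sub_smul_one_ne_zero_iff hF.toOrthogonalIdempotents hα ε _ hij,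
        DRG.idempotent_mul_dualDistanceMatrix_ne_zero_iff hG.connected hdiam hE hP hQ hp, hone]
      exact DRG.intersection_number_one_ne_zero_iff hG hdiam x hp (by omega) (by omega)
        (fun h => hij (Fin.ext h)) (by omega)
    have key := DRG.conj_eq_iff hF B (fun i => DRG.vartheta a q D i) c hc
      (q * (q ^ 2 - q ^ (-2 : ℤ))⁻¹) (q⁻¹ * (q ^ 2 - q ^ (-2 : ℤ))⁻¹) _
      (fun i j h hij => by simp [hij] at h) hblock
    refine DRG.tfae_of_iff_ratio hq0 hq1 hq2 ha c hc ?_ ?_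
    · refine ⟨fun h i j hij => h j i (by rwa [abs_sub_comm]),
        fun h i j hij => h j i (by rwa [abs_sub_comm])⟩
    · rw [DRG.inv_sum_smul hF hc, hC, hZ']
      rw [hkq, ← hAsum] at key
      convert key using 2
      · rw [smul_sub, smul_smul, smul_smul, mul_comm q, mul_comm q⁻¹]
      · refine forall_congr' fun j => forall_congr' fun _ => ?_
        rw [div_eq_mul_inv _ (q ^ 2 - q ^ (-2 : ℤ)), sub_mul]
        simp only [mul_right_comm]
  · rintro W' - hW c rfl
    have hc := DRG.coeff_ne_zero_of_isUnit hF'.toOrthogonalIdempotents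
      (fun i => DRG.dualIdempotent_ne_zero hG hdiam x (by omega)) hW
    have hblock : ∀ i j : Fin (D + 1), i ≠ j →
        (DRG.dualIdempotent G x i * A * DRG.dualIdempotent G x j ≠ 0 ↔
          |(i : ℤ) - (j : ℤ)| = 1) := by
      intro i j hij
      rw [hA, DRG.block_smul_sub_smul_one_ne_zero_iff hF'.toOrthogonalIdempotents hα ε _ hij]
      exact DRG.dualIdempotent_mul_distanceMatrix_one_ne_zero_iff hG hdiam x (by omega)
        (by omega) (fun h => hij (Fin.ext h))
    -- The conjugation is now by $W^*$ on the left, hence the inverse coefficients. The matrix with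
    -- eigenvalues $\vartheta_i$ is now $\mathsf B$, so $q\mathsf A\mathsf B-q^{-1}\mathsf B\mathsf
    -- A$ is read as $(-q^{-1})\mathsf B\mathsf A-(-q)\mathsf A\mathsf B$; the difference $u-v$ is
    -- unchanged.
    have key := DRG.conj_eq_iff hF' A (fun i => DRG.vartheta a q D i) (fun i => (c i)⁻¹)
      (fun i => inv_ne_zero (hc i))
      (-(q⁻¹ * (q ^ 2 - q ^ (-2 : ℤ))⁻¹)) (-(q * (q ^ 2 - q ^ (-2 : ℤ))⁻¹)) _
      (fun i j h hij => by simp [hij] at h) hblock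
    refine DRG.tfae_of_iff_ratio hq0 hq1 hq2 ha c hc Iff.rfl ?_
    rw [DRG.inv_sum_smul hF' hc, hC, hZ]
    rw [neg_sub_neg, hkq, ← hBsum] at key
    simp only [inv_inv] at key
    convert key using 2
    · rw [smul_sub, smul_smul, smul_smul, mul_comm q, mul_comm q⁻¹]
      simp only [neg_smul]
      abel
    · refine forall_congr' fun j => forall_congr' fun _ => ?_
      rw [div_eq_mul_inv _ (q ^ 2 - q ^ (-2 : ℤ)), sub_mul, inv_div_inv]
      simp only [mul_right_comm, neg_mul, sub_neg_eq_add, neg_add_eq_sub]
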